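/- For an ordinal $\gamma$, identified with the set of smaller ordinals and given the order topology, let $[\gamma]^2$ denote the set of its two-element subsets. A subset $X\subseteq\gamma$ with the subspace topology is a \emph{closed copy} of an ordinal $\delta$ if there is a bijection $X\to\delta$ that is both an order-isomorphism and a homeomorphism. For a coloring $c:[\gamma]^2\to\{\text{red},\text{blue}\}$, a set $X\subseteq\gamma$ is \emph{red-homogeneous} (respectively \emph{blue-homogeneous}) if every two-element subset of $X$ is colored red (respectively blue). Write $\gamma\to_{cl}(\delta,m)^2$ if for every coloring $c:[\gamma]^2\to\{\text{red},\text{blue}\}$ there is a red-homogeneous closed copy of $\delta$ or a blue-homogeneous closed copy of $m$ in $\gamma$; for finite $m$ the latter is just a blue-homogeneous set of $m$ points. Let $\alpha$ and $\beta$ be countable ordinals with $\beta>0$, and let $k$ be a positive integer. Suppose that they satisfy the following cofinal version of $\omega^{\omega^\alpha}\to_{cl}(\omega^\beta,k+2)^2$: for every coloring $c:[\omega^{\omega^\alpha}]^2\to\{\text{red},\text{blue}\}$, \begin{itemize} \item there is a blue-homogeneous set of $k+2$ points, or \item there is a red-homogeneous closed copy of $\omega^\beta$ that is cofinal in $\omega^{\omega^\alpha}$,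 or \item there is a red-homogeneous closed copy of $\omega^\beta+1$. \end{itemize} Then \[\omega^{\omega^\alpha\cdot(k+1)}+1\to_{cl}(\omega^\beta+1,k+2)^2.\] Moreover, if $\omega^{\omega^\alpha}>\omega^\beta$, then in fact \[\omega^{\omega^\alpha\cdot k}+1\to_{cl}(\omega^\beta+1,k+2)^2.\] Here all operations on ordinals are the usual ordinal arithmetic. -/

import Mathlib

open scoped Ordinal Cardinal

universe u

/-- `X` is order-homeomorphic to `α`: some bijection from `X` (with the subspace topology) onto
the set of ordinals below `α` is both an order isomorphism and a homeomorphism. -/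
def IsClosedCopy {T : Type*} [LE T] [TopologicalSpace T] (X : Set T) (α : Ordinal.{u}) : Prop :=
  ∃ e : X ≃o Set.Iio α, IsHomeomorph e

/-- All `n`-element subsets of `X` have colour `i` under the colouring `c` of `[T]^n`. -/
def IsHomogeneous {T ι : Type*} {n : ℕ} (c : Set.powersetCard T n → ι) (X : Set T) (i : ι) :
    Prop :=
  ∀ s : Set.powersetCard T n, ((s : Finset T) : Set T) ⊆ X → c s = i

/-- The closed partition relation `β →_cl (α_i)^n_{i ∈ ι}`. The ordinal `β` is represented by the
set of ordinals below it, on which the subspace topology is the order topology. -/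
def ClosedArrow {ι : Type*} (β : Ordinal.{u}) (α : ι → Ordinal.{u}) (n : ℕ) : Prop :=
  ∀ c : Set.powersetCard (Set.Iio β) n → ι,
    ∃ (X : Set (Set.Iio β)) (i : ι), IsHomogeneous c X i ∧ IsClosedCopy X (α i)

/-- The cofinal version of `γ →_cl (δ, m)^2`; colour `0` is red and colour `1` is blue. -/
def CofinalClosedArrow (γ δ : Ordinal.{u}) (m : ℕ) : Prop :=
  ∀ c : Set.powersetCard (Set.Iio γ) 2 → Fin 2,
    (∃ B : Finset (Set.Iio γ), B.card = m ∧ IsHomogeneous c (B : Set (Set.Iio γ)) 1) ∨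
    (∃ X : Set (Set.Iio γ), IsHomogeneous c X 0 ∧ IsClosedCopy X δ ∧ IsCofinal X) ∨
    (∃ X : Set (Set.Iio γ), IsHomogeneous c X 0 ∧ IsClosedCopy X (δ + 1))

open Filter Topology

/-! Measure points by a Cantor–Bendixson rank relative to a set A (`AccRank`). Two facts drive the
proof. In a countable order, a point p of rank b > 0 over A is the top of a closed copy of ω^b + 1
whose other points lie in A (`exists_closedCopy_of_accRank`). The rank over a union is at most the
natural sum of the two ranks (`AccRank.union`).

Assume there is neither a red copy of ω^β + 1 nor a blue set of k + 2 points. If p had rank ω^α over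
its non-blue neighbours, they would contain a closed copy of ω^(ω^α) converging to p. The cofinal
hypothesis applied to that copy gives one of the excluded sets, since a red cofinal copy of ω^β is
completed by p. So the non-blue rank of p is below ω^α. If p has rank ω^α·(n+1) over U, the
pigeonhole yields a blue neighbour y in U of rank ω^α·n over the blue neighbours of p in U. A blue
set found by recursion at y lies among those neighbours, so p can be added to it.

The top point ω^γ has rank γ. From γ = ω^α·(k+1), k + 1 descents from a single point give k + 2 blue
points. If β < ω^α, rank ω^α already yields a blue triangle, which saves one factor ω^α. -/

/-- `NatAddLE a b c` says that the natural (Hessenberg) sum of `a` and `b` is at most `c`. -/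
inductive NatAddLE : Ordinal.{u} → Ordinal.{u} → Ordinal.{u} → Prop
  | intro (a b c : Ordinal.{u}) (f g : Ordinal.{u} → Ordinal.{u})
      (hf : ∀ a' < a, f a' < c) (hf' : ∀ a' < a, NatAddLE a' b (f a'))
      (hg : ∀ b' < b, g b' < c) (hg' : ∀ b' < b, NatAddLE a b' (g b')) : NatAddLE a b c

/-! ### Natural sums through their recursion. -/

namespace NatAddLE

theorem of_forall_exists {a b c : Ordinal.{u}} (h₁ : ∀ a' < a, ∃ c' < c, NatAddLE a' b c')
    (h₂ : ∀ b' < b, ∃ c' < c, NatAddLE a b' c') : NatAddLE a b c := by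
  choose! f hf hf' using h₁
  choose! g hg hg' using h₂
  exact intro a b c f g hf hf' hg hg'

theorem exists_left {a b c : Ordinal.{u}} (h : NatAddLE a b c) :
    ∀ a' < a, ∃ c' < c, NatAddLE a' b c' := by
  cases h with
  | intro _ _ _ f g hf hf' hg hg' => exact fun a' h => ⟨f a', hf a' h, hf' a' h⟩

theorem exists_right {a b c : Ordinal.{u}} (h : NatAddLE a b c) :
    ∀ b' < b, ∃ c' < c, NatAddLE a b' c' := by
  cases h with
  | intro _ _ _ f g hf hf' hg hg' => exact fun a' h => ⟨g a', hg a' h, hg' a' h⟩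

/-- An ordinal below `ω ^ e * n + x` with `x < ω ^ e` splits off a smaller multiple of `ω ^ e`,
or the same multiple with a smaller remainder. -/
theorem lt_decompose {e a x : Ordinal.{u}} {n : ℕ} (hx : x < ω ^ e) (h : a < ω ^ e * n + x) :
    ∃ (m : ℕ) (y : Ordinal.{u}), a = ω ^ e * m + y ∧ y < ω ^ e ∧ (m < n ∨ m = n ∧ y < x) := by
  have hpos : (ω : Ordinal.{u}) ^ e ≠ 0 := (Ordinal.opow_pos e Ordinal.omega0_pos).ne'
  have hlt : a < ω ^ e * ((n + 1 : ℕ) : Ordinal.{u}) := by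
    push_cast
    rw [mul_add, mul_one]
    exact h.trans (by gcongr)
  have hd : a / ω ^ e < ((n + 1 : ℕ) : Ordinal.{u}) := (Ordinal.lt_mul_iff_div_lt hpos).1 hlt
  obtain ⟨m, hm⟩ := Ordinal.lt_omega0.1 (hd.trans (Ordinal.natCast_lt_omega0 _))
  have hdm := Ordinal.div_add_mod a (ω ^ e)
  rw [hm] at hd hdm
  have hmn : m < n + 1 := by exact_mod_cast hd
  refine ⟨m, a % ω ^ e, hdm.symm, Ordinal.mod_lt _ hpos, ?_⟩
  rcases Nat.lt_succ_iff_lt_or_eq.1 hmn with h' | rfl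
  · exact Or.inl h'
  · refine Or.inr ⟨rfl, ?_⟩
    rw [← hdm] at h
    exact lt_of_add_lt_add_left h

/-- Lowering a coefficient lowers the total coefficient, after which any remainder below ω^e is
affordable; `he` supplies one. Lowering only a remainder is the recursion for x, y, c. Hence an
outer induction on s and an inner one on the derivation. -/
theorem opow_mul_add {e : Ordinal.{u}}
    (he : ∀ a < ω ^ e, ∀ b < ω ^ e, ∃ c < ω ^ e, NatAddLE a b c) :
    ∀ (s n m : ℕ), n + m = s → ∀ {x y c : Ordinal.{u}}, NatAddLE x y c → x < ω ^ e → y < ω ^ e →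
      c < ω ^ e → NatAddLE (ω ^ e * n + x) (ω ^ e * m + y) (ω ^ e * (s : Ordinal.{u}) + c) := by
  intro s
  induction s using Nat.strong_induction_on with
  | _ s ih =>
    intro n m hs x y c h
    induction h with
    | intro x y c f g hf hf' hg hg' ihf ihg =>
      intro hx hy hc
      have key : ∀ (s' : ℕ), s' < s → ∀ c' < ω ^ e,
          ω ^ e * (s' : Ordinal.{u}) + c' < ω ^ e * (s : Ordinal.{u}) + c := by
        intro s' hs' c' hc'
        calc ω ^ e * (s' : Ordinal.{u}) + c' < ω ^ e * (s' : Ordinal.{u}) + ω ^ e := by gcongr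
          _ = ω ^ e * ((s' + 1 : ℕ) : Ordinal.{u}) := by push_cast; rw [mul_add, mul_one]
          _ ≤ ω ^ e * (s : Ordinal.{u}) := by
            gcongr
            exact_mod_cast hs'
          _ ≤ _ := le_self_add
      apply of_forall_exists
      · intro a' ha'
        obtain ⟨k, z, rfl, hz, hk | ⟨rfl, hk⟩⟩ := lt_decompose hx ha'
        · obtain ⟨c', hc', hN⟩ := he z hz y hy
          exact ⟨_, key (k + m) (by omega) c' hc', ih (k + m) (by omega) k m rfl hN hz hy hc'⟩
        · exact ⟨_, by gcongr; exact hf z hk, ihf z hk hz hy ((hf z hk).trans hc)⟩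
      · intro a' ha'
        obtain ⟨k, z, rfl, hz, hk | ⟨rfl, hk⟩⟩ := lt_decompose hy ha'
        · obtain ⟨c', hc', hN⟩ := he x hx z hz
          exact ⟨_, key (n + k) (by omega) c' hc', ih (n + k) (by omega) n k rfl hN hx hz hc'⟩
        · exact ⟨_, by gcongr; exact hg z hk, ihg z hk hx hz ((hg z hk).trans hc)⟩

/-- Powers of ω are closed under natural sums: both summands are expanded over one common ω^d with d
< e, and the remainders are handled by induction. -/
theorem exists_lt_opow (e : Ordinal.{u}) :
    ∀ a < ω ^ e, ∀ b < ω ^ e, ∃ c < ω ^ e, NatAddLE a b c := by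
  induction e using WellFoundedLT.induction with
  | _ e ih =>
    intro a ha b hb
    rcases eq_or_ne e 0 with rfl | he
    · simp only [Ordinal.opow_zero, Order.lt_one_iff] at ha hb
      subst ha hb
      exact ⟨0, by simp, of_forall_exists (by simp) (by simp)⟩
    · obtain ⟨e₁, he₁, n, hn⟩ := (Ordinal.lt_omega0_opow he).1 ha
      obtain ⟨e₂, he₂, m, hm⟩ := (Ordinal.lt_omega0_opow he).1 hb
      set d := max e₁ e₂
      have hd : d < e := max_lt he₁ he₂
      have hpos : (0 : Ordinal.{u}) < ω ^ d := Ordinal.opow_pos _ Ordinal.omega0_pos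
      have hn' : a < ω ^ d * n + 0 := by
        rw [add_zero]
        refine hn.trans_le ?_
        gcongr
        · exact Ordinal.omega0_pos
        · exact le_max_left _ _
      have hm' : b < ω ^ d * m + 0 := by
        rw [add_zero]
        refine hm.trans_le ?_
        gcongr
        · exact Ordinal.omega0_pos
        · exact le_max_right _ _
      obtain ⟨i, x, rfl, hx, -⟩ := lt_decompose hpos hn'
      obtain ⟨j, y, rfl, hy, -⟩ := lt_decompose hpos hm'
      obtain ⟨c, hc, hN⟩ := ih d hd x hx y hy
      refine ⟨_, ?_, opow_mul_add (ih d hd) (i + j) i j rfl hN hx hy hc⟩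
      refine (Ordinal.lt_omega0_opow he).2 ⟨d, hd, i + j + 1, ?_⟩
      push_cast
      rw [mul_add _ _ 1, mul_one]
      gcongr

end NatAddLE

/-! ### Relative Cantor–Bendixson rank and the pigeonhole principle. -/

section AccRank

variable {T : Type*} [LinearOrder T] [TopologicalSpace T]

/-- The point `p` has Cantor-Bendixson rank at least `b` in the subspace `A ∪ {p}`, where only
accumulation from below is considered. -/
def AccRank (A : Set T) (b : Ordinal.{u}) (p : T) : Prop :=
  ∀ b' < b, ∃ᶠ y in 𝓝[<] p, y ∈ A ∧ AccRank A b' y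
termination_by b

theorem accRank_iff {A : Set T} {b : Ordinal.{u}} {p : T} :
    AccRank A b p ↔ ∀ b' < b, ∃ᶠ y in 𝓝[<] p, y ∈ A ∧ AccRank A b' y := by
  rw [AccRank]

theorem AccRank.anti {A : Set T} {b b' : Ordinal.{u}} {p : T} (h : AccRank A b p) (hb : b' ≤ b) :
    AccRank A b' p := by
  rw [accRank_iff] at h ⊢
  exact fun c hc => h c (hc.trans_le hb)

theorem accRank_add_one_iff {A : Set T} {b : Ordinal.{u}} {p : T} :
    AccRank A (b + 1) p ↔ ∃ᶠ y in 𝓝[<] p, y ∈ A ∧ AccRank A b y := by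
  rw [accRank_iff]
  refine ⟨fun h => h b (Order.lt_add_one_iff.2 le_rfl), fun h c hc => h.mono fun y hy => ⟨hy.1, ?_⟩⟩
  exact hy.2.anti (Order.lt_add_one_iff.1 hc)

theorem exists_lt_not_accRank_add_one {A : Set T} {b : Ordinal.{u}} {p : T}
    (h : ¬ AccRank A b p) : ∃ c < b, ¬ AccRank A (c + 1) p := by
  rw [accRank_iff] at h
  push Not at h
  obtain ⟨c, hc, h⟩ := h
  refine ⟨c, hc, fun hc => ?_⟩
  rw [accRank_add_one_iff] at hc
  exact hc (h.mono fun y hy => by tauto)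

theorem eventually_eventually_nhdsLT [OrderTopology T] {P : T → Prop} {p : T}
    (h : ∀ᶠ y in 𝓝[<] p, P y) : ∀ᶠ y in 𝓝[<] p, ∀ᶠ z in 𝓝[<] y, P z := by
  filter_upwards [eventually_eventually_nhdsWithin.2 h, self_mem_nhdsWithin] with y hy hyp
  refine hy.filter_mono (nhdsWithin_mono _ fun z hz => ?_)
  exact lt_trans hz hyp

/-- The topological pigeonhole principle: the rank of a point in a union is at most the natural
sum of its ranks in the two pieces. -/
theorem AccRank.union [OrderTopology T] {A B : Set T} {γ : Ordinal.{u}} {p : T}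
    (h : AccRank (A ∪ B) γ p) {a b c : Ordinal.{u}} (hN : NatAddLE a b c) (hc : c < γ) :
    AccRank A (a + 1) p ∨ AccRank B (b + 1) p := by
  induction γ using WellFoundedLT.induction generalizing p a b c with
  | _ γ ih =>
    by_contra! hcon
    obtain ⟨hA, hB⟩ := hcon
    rw [accRank_add_one_iff, not_frequently] at hA hB
    rw [accRank_iff] at h
    -- Choose y of rank c so close to p that the failure of both ranks holds at y and also just
    -- below y. If y ∈ A, its A-rank drops below a, so the induction at y with a smaller sum forces
    -- a B-rank that the failure below y forbids; symmetrically for B.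
    obtain ⟨y, ⟨hy, hyr⟩, ⟨hAy, hAy'⟩, hBy, hBy'⟩ := ((h c hc).and_eventually
      ((hA.and (eventually_eventually_nhdsLT hA)).and
        (hB.and (eventually_eventually_nhdsLT hB)))).exists
    rcases hy with hy | hy
    · obtain ⟨a', ha', hn⟩ := exists_lt_not_accRank_add_one fun h => hAy ⟨hy, h⟩
      obtain ⟨c', hc', hN'⟩ := hN.exists_left a' ha'
      rcases ih c hc hyr hN' hc' with h | h
      · exact hn h
      · rw [accRank_add_one_iff] at h
        exact h hBy'
    · obtain ⟨b', hb', hn⟩ := exists_lt_not_accRank_add_one fun h => hBy ⟨hy, h⟩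
      obtain ⟨c', hc', hN'⟩ := hN.exists_right b' hb'
      rcases ih c hc hyr hN' hc' with h | h
      · rw [accRank_add_one_iff] at h
        exact h hAy'
      · exact hn h

end AccRank

/-! ### Building normal maps by joining blocks. -/

section Copies

variable {T : Type*} [LinearOrder T]

/-- The restriction of `g` to the ordinals in the interval `(0, θ]` is strictly increasing and
continuous. -/
def IsNormalOn (g : Ordinal.{u} → T) (θ : Ordinal.{u}) : Prop :=
  (∀ x y, 0 < x → x < y → y ≤ θ → g x < g y) ∧
    ∀ x ≤ θ, Order.IsSuccLimit x → ∀ t < g x, ∃ y, 0 < y ∧ y < x ∧ t < g y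

/-- Blocks of consecutive lengths `d n` mapping into consecutive intervals `(P n, P (n + 1)]`
are joined to one map, with a limit point added on top. -/
theorem IsNormalOn.concat {S d : ℕ → Ordinal.{u}} {θ : Ordinal.{u}} {P : ℕ → T} {p : T}
    {g : ℕ → Ordinal.{u} → T} (hS₀ : S 0 = 0) (hS : ∀ n, S (n + 1) = S n + d n)
    (hd : ∀ n, 0 < d n) (hSθ : ∀ n, S n < θ) (hθ : ∀ x < θ, ∃ n, x ≤ S (n + 1))
    (hP : ∀ n, P n < p) (hPp : ∀ t < p, ∃ n, t < P n) (hg : ∀ n, IsNormalOn (g n) (d n))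
    (hgP : ∀ n u, 0 < u → u ≤ d n → P n < g n u ∧ g n u ≤ P (n + 1)) :
    ∃ G : Ordinal.{u} → T, IsNormalOn G θ ∧ G θ = p ∧
      ∀ x, 0 < x → x < θ → ∃ n u, 0 < u ∧ u ≤ d n ∧ G x = g n u := by
  classical
  let G : Ordinal.{u} → T := fun x =>
    -- `Nat.find` selects the block containing x; θ lies in no block, so the default value p becomes
    -- the value at the top.
    if h : ∃ n, x ≤ S (n + 1) then g (Nat.find h) (x - S (Nat.find h)) else p
  have hSm : StrictMono S := strictMono_nat_of_lt_succ fun n => by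
    rw [hS]; exact lt_add_of_pos_right _ (hd n)
  have hPm : Monotone P := monotone_nat_of_le_succ fun n =>
    ((hgP n (d n) (hd n) le_rfl).1.trans_le (hgP n (d n) (hd n) le_rfl).2).le
  have hGb : ∀ n u, 0 < u → u ≤ d n → G (S n + u) = g n u := by
    intro n u hu hun
    have hex : ∃ m, S n + u ≤ S (m + 1) := ⟨n, by rw [hS]; gcongr⟩
    have hfind : Nat.find hex = n := by
      rw [Nat.find_eq_iff]
      refine ⟨by rw [hS]; gcongr, fun m hm hle => ?_⟩
      have h1 : S (m + 1) ≤ S n := hSm.monotone hm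
      exact absurd (hle.trans h1) (not_le.2 (lt_add_of_pos_right _ hu))
    simp only [G, dif_pos hex, hfind, Ordinal.add_sub_cancel]
  have hGθ : G θ = p := by
    refine dif_neg ?_
    rintro ⟨n, hn⟩
    exact absurd hn (not_le.2 (hSθ _))
  have hdec : ∀ x, 0 < x → x < θ → ∃ n u, 0 < u ∧ u ≤ d n ∧ x = S n + u := by
    intro x hx hxθ
    have hex := hθ x hxθ
    have hlt : S (Nat.find hex) < x := by
      rcases h : Nat.find hex with _ | m
      · rwa [hS₀]
      · exact not_le.1 (Nat.find_min hex (m := m) (by omega))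
    have hx' := Ordinal.add_sub_cancel_of_le hlt.le
    refine ⟨Nat.find hex, x - S (Nat.find hex), ?_, ?_, hx'.symm⟩
    · rw [pos_iff_ne_zero]
      intro h0
      rw [h0, add_zero] at hx'
      exact hlt.ne hx'
    · rw [Ordinal.sub_le, ← hS]
      exact Nat.find_spec hex
  have hsucc : ∀ n, S n + d n < θ := fun n => hS n ▸ hSθ (n + 1)
  refine ⟨G, ⟨?_, ?_⟩, hGθ, ?_⟩
  · intro x y hx hxy hy
    obtain ⟨n, u, hu, hun, rfl⟩ := hdec x hx (hxy.trans_le hy)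
    rw [hGb n u hu hun]
    rcases hy.lt_or_eq with hy | rfl
    · obtain ⟨m, v, hv, hvm, rfl⟩ := hdec y (hx.trans hxy) hy
      rw [hGb m v hv hvm]
      rcases lt_trichotomy n m with hnm | rfl | hnm
      · exact ((hgP n u hu hun).2.trans (hPm hnm)).trans_lt (hgP m v hv hvm).1
      · exact (hg n).1 u v hu (lt_of_add_lt_add_left hxy) hvm
      · exfalso
        refine absurd hxy (not_lt.2 ?_)
        calc S m + v ≤ S (m + 1) := by rw [hS]; gcongr
          _ ≤ S n := hSm.monotone hnm
          _ ≤ _ := le_self_add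
    · rw [hGθ]
      exact (hgP n u hu hun).2.trans_lt (hP _)
  · intro x hx hlim t ht
    rcases hx.lt_or_eq with hx | rfl
    · obtain ⟨n, u, hu, hun, rfl⟩ := hdec x hlim.bot_lt hx
      rw [hGb n u hu hun] at ht
      have hulim : Order.IsSuccLimit u := by
        rcases Ordinal.isSuccLimit_add_iff.1 hlim with h | h
        · exact h
        · exact absurd h.1 hu.ne'
      obtain ⟨v, hv, hvu, htv⟩ := (hg n).2 u hun hulim t ht
      refine ⟨S n + v, hv.trans_le le_add_self, by gcongr, ?_⟩
      rwa [hGb n v hv (hvu.le.trans hun)]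
    · rw [hGθ] at ht
      obtain ⟨n, hn⟩ := hPp t ht
      refine ⟨S n + d n, (hd n).trans_le le_add_self, hsucc n, ?_⟩
      rw [hGb n _ (hd n) le_rfl]
      exact hn.trans (hgP n _ (hd n) le_rfl).1
  · intro x hx hxθ
    obtain ⟨n, u, hu, hun, rfl⟩ := hdec x hx hxθ
    exact ⟨n, u, hu, hun, hGb n u hu hun⟩

/-- List the ranks below b with each occurring infinitely often, and choose points of those ranks in
A increasing to p. Induction fills the gap below the n-th point with a block of length ω^(c n); the
repetitions make the lengths sum to ω^b. -/
theorem exists_isNormalOn_of_accRank [TopologicalSpace T] [OrderTopology T] [Countable T]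
    {A : Set T} {b : Ordinal.{u}} (hb : b.card ≤ ℵ₀) {p q : T} (hqp : q < p)
    (h : AccRank A b p) :
    ∃ g : Ordinal.{u} → T, IsNormalOn g (ω ^ b) ∧ g (ω ^ b) = p ∧
      ∀ x, 0 < x → x < ω ^ b → q < g x ∧ g x ∈ A := by
  induction b using WellFoundedLT.induction generalizing p q with
  | _ b ih =>
    rcases eq_or_ne b 0 with rfl | hb0
    · refine ⟨fun _ => p, ⟨?_, ?_⟩, rfl, ?_⟩
      · intro x y hx hxy hy
        simp only [Ordinal.opow_zero] at hy
        exact absurd (hxy.trans_le hy) (by simpa using hx.ne')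
      · intro x hx hlim
        simp only [Ordinal.opow_zero] at hx
        exact absurd (by simpa using hlim.add_one_lt hlim.bot_lt) (not_lt.2 hx)
      · intro x hx hx1
        simp only [Ordinal.opow_zero] at hx1
        exact absurd hx1 (by simpa using hx.ne')
    · have hbpos : 0 < b := pos_iff_ne_zero.2 hb0
      have : Countable (Set.Iio b) := by
        rw [← Cardinal.mk_le_aleph0_iff, Cardinal.mk_Iio_ordinal,
          Cardinal.lift_le_aleph0]
        exact hb
      have : Nonempty (Set.Iio b) := ⟨⟨0, hbpos⟩⟩
      have : Nonempty T := ⟨p⟩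
      obtain ⟨e, he⟩ := exists_surjective_nat (Set.Iio b)
      obtain ⟨t, ht⟩ := exists_surjective_nat T
      let c : ℕ → Ordinal.{u} := fun n => e n.unpair.1
      have hcb : ∀ n, c n < b := fun n => (e n.unpair.1).2
      have hcf : ∀ x < b, ∀ N, ∃ n ≥ N, c n = x := by
        intro x hx N
        obtain ⟨i, hi⟩ := he ⟨x, hx⟩
        exact ⟨Nat.pair i N, Nat.right_le_pair _ _, by simp [c, hi]⟩
      -- Passing `t n`, the n-th point of an enumeration of T, makes the sequence cofinal below p.
      have hstep : ∀ (n : ℕ) (v : T), ∃ w, v < p → v < w ∧ w < p ∧ w ∈ A ∧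
          AccRank A (c n) w ∧ (t n < p → t n < w) := by
        intro n v
        by_cases hv : v < p
        · rw [accRank_iff] at h
          by_cases htn : t n < p
          · obtain ⟨w, ⟨hwA, hw⟩, hvw, hwp⟩ := ((h (c n) (hcb n)).and_eventually
              (Ioo_mem_nhdsLT (max_lt hv htn))).exists
            exact ⟨w, fun _ => ⟨(le_max_left _ _).trans_lt hvw, hwp, hwA, hw,
              fun _ => (le_max_right _ _).trans_lt hvw⟩⟩
          · obtain ⟨w, ⟨hwA, hw⟩, hvw, hwp⟩ := ((h (c n) (hcb n)).and_eventually
              (Ioo_mem_nhdsLT hv)).exists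
            exact ⟨w, fun _ => ⟨hvw, hwp, hwA, hw, fun h => absurd h htn⟩⟩
        · exact ⟨p, fun h => absurd h hv⟩
      choose st hst using hstep
      let P : ℕ → T := fun n => Nat.rec q (fun n v => st n v) n
      have hPs : ∀ n, P (n + 1) = st n (P n) := fun n => rfl
      have hPp : ∀ n, P n < p := by
        intro n
        induction n with
        | zero => exact hqp
        | succ n ihn => rw [hPs]; exact (hst n (P n) ihn).2.1
      have hP : ∀ n, P n < P (n + 1) ∧ P (n + 1) ∈ A ∧ AccRank A (c n) (P (n + 1)) ∧
          (t n < p → t n < P (n + 1)) := fun n => by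
        obtain ⟨h1, h2, h3, h4, h5⟩ := hst n (P n) (hPp n)
        exact ⟨h1, h3, h4, h5⟩
      have hqP : ∀ n, q ≤ P n := fun n =>
        (monotone_nat_of_le_succ fun n => (hP n).1.le : Monotone P) (Nat.zero_le n)
      have hblock := fun n => ih (c n) (hcb n)
        ((Ordinal.card_le_card (hcb n).le).trans hb) (hP n).1 (hP n).2.2.1
      choose g hg hgtop hgA using hblock
      let S : ℕ → Ordinal.{u} := fun n => Nat.rec 0 (fun n x => x + ω ^ c n) n
      have hS : ∀ n, S (n + 1) = S n + ω ^ c n := fun n => rfl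
      have hSb : ∀ n, S n < ω ^ b := by
        intro n
        induction n with
        | zero => exact Ordinal.opow_pos _ Ordinal.omega0_pos
        | succ n ihn =>
          rw [hS]
          exact Ordinal.isPrincipal_add_omega0_opow b ihn
            ((Ordinal.opow_lt_opow_iff_right Ordinal.one_lt_omega0).2 (hcb n))
      have hSm : Monotone S := monotone_nat_of_le_succ fun n => by rw [hS]; exact le_self_add
      have hScof : ∀ x < b, ∀ m : ℕ, ∃ n, ω ^ x * m ≤ S n := by
        intro x hx m
        induction m with
        | zero => exact ⟨0, by simp⟩
        | succ m ihm =>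
          obtain ⟨n, hn⟩ := ihm
          obtain ⟨k, hk, hkx⟩ := hcf x hx n
          refine ⟨k + 1, ?_⟩
          rw [hS, hkx]
          push_cast
          rw [mul_add, mul_one]
          gcongr
          exact hn.trans (hSm hk)
      obtain ⟨G, hG, hGtop, hGA⟩ := IsNormalOn.concat (S := S) (d := fun n => ω ^ c n)
        (θ := ω ^ b) (P := P) (p := p) (g := g) rfl hS
        (fun n => Ordinal.opow_pos _ Ordinal.omega0_pos) hSb
        (fun x hx => by
          obtain ⟨y, hy, m, hm⟩ := (Ordinal.lt_omega0_opow hb0).1 hx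
          obtain ⟨n, hn⟩ := hScof y hy m
          exact ⟨n, hm.le.trans (hn.trans (hSm n.le_succ))⟩)
        hPp
        (fun s hs => by
          obtain ⟨n, rfl⟩ := ht s
          exact ⟨n + 1, (hP n).2.2.2 hs⟩)
        hg
        (fun n x hx hxn => by
          rcases hxn.lt_or_eq with hlt | rfl
          · refine ⟨(hgA n x hx hlt).1, ?_⟩
            rw [← hgtop n]
            exact ((hg n).1 x _ hx hlt le_rfl).le
          · rw [hgtop n]
            exact ⟨(hP n).1, le_rfl⟩)
      refine ⟨G, hG, hGtop, fun x hx hxb => ?_⟩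
      obtain ⟨n, y, hy, hyn, hxy⟩ := hGA x hx hxb
      rw [hxy]
      rcases hyn.lt_or_eq with hlt | rfl
      · exact ⟨(hqP n).trans_lt (hgA n y hy hlt).1, (hgA n y hy hlt).2⟩
      · rw [hgtop n]
        exact ⟨(hqP n).trans_lt (hP n).1, (hP n).2.1⟩

end Copies

/-! ### Closed copies as ranges of strictly increasing continuous maps. -/

section Maps

variable {T : Type*} [LinearOrder T] [TopologicalSpace T] [OrderTopology T]

/-- Non-limit ordinals are isolated, and continuity from the right is automatic because Iic x is
open; only approach from below at limits needs checking. -/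
theorem StrictMono.continuous_of_isSuccLimit {θ : Ordinal.{u}} {f : Set.Iio θ → T}
    (hf : StrictMono f)
    (h : ∀ x : Set.Iio θ, Order.IsSuccLimit (x : Ordinal.{u}) → ∀ t < f x, ∃ y < x, t < f y) :
    Continuous f := by
  rw [continuous_iff_continuousAt]
  intro x
  refine tendsto_order.2 ⟨fun t ht => ?_, fun t ht => ?_⟩
  · by_cases hx : Order.IsSuccLimit (x : Ordinal.{u})
    · obtain ⟨y, hyx, hy⟩ := h x hx t ht
      filter_upwards [Ioi_mem_nhds hyx] with z hz
      exact hy.trans (hf hz)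
    · have ho : IsOpen ((↑) ⁻¹' {(x : Ordinal.{u})} : Set (Set.Iio θ)) :=
        (SuccOrder.isOpen_singleton_iff.2 hx).preimage continuous_subtype_val
      filter_upwards [ho.mem_nhds rfl] with z hz
      rwa [Subtype.ext hz]
  · have ho : IsOpen ((↑) ⁻¹' Set.Iio ((x : Ordinal.{u}) + 1) : Set (Set.Iio θ)) :=
      isOpen_Iio.preimage continuous_subtype_val
    filter_upwards [ho.mem_nhds (show (x : Ordinal.{u}) < x + 1 from
      Order.lt_add_one_iff.2 le_rfl)] with z hz
    exact (hf.monotone (show (z : Ordinal.{u}) ≤ x from Order.lt_add_one_iff.1 hz)).trans_lt ht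

theorem Continuous.exists_lt_of_isSuccLimit {θ : Ordinal.{u}} {f : Set.Iio θ → T}
    (hf : Continuous f) {x : Set.Iio θ} (hx : Order.IsSuccLimit (x : Ordinal.{u})) {t : T}
    (ht : t < f x) : ∃ y < x, t < f y := by
  have hn : f ⁻¹' Set.Ioi t ∈ 𝓝 x := hf.continuousAt (Ioi_mem_nhds ht)
  obtain ⟨l, hl, hlx⟩ := exists_Ioc_subset_of_mem_nhds hn
    ⟨⟨0, hx.bot_lt.trans x.2⟩, hx.bot_lt⟩
  have hl1 : (l : Ordinal.{u}) + 1 < x := hx.add_one_lt hl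
  have hl1' : (⟨l + 1, hl1.trans x.2⟩ : Set.Iio θ) < x := hl1
  refine ⟨_, hl1', hlx (Set.mem_Ioc.2 ⟨?_, hl1'.le⟩)⟩
  exact Order.lt_add_one_iff.2 (le_refl (l : Ordinal.{u}))

theorem isClosedCopy_range {θ : Ordinal.{u}} {f : Set.Iio θ → T} (hf : StrictMono f)
    (hc : Continuous f) : IsClosedCopy (Set.range f) θ := by
  have hind : IsEmbedding f := by
    refine ⟨⟨le_antisymm hc.le_induced ?_⟩, hf.injective⟩
    rw [OrderTopology.topology_eq_generate_intervals (α := Set.Iio θ)]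
    exact induced_topology_le_preorder hf.lt_iff_lt
  refine ⟨(hf.orderIso f).symm, ?_⟩
  exact hind.toHomeomorph.symm.isHomeomorph

theorem IsClosedCopy.exists_strictMono_continuous {T : Type*} [LinearOrder T]
    [TopologicalSpace T] {θ : Ordinal.{u}} {X : Set T} (h : IsClosedCopy X θ) :
    ∃ f : Set.Iio θ → T, StrictMono f ∧ Continuous f ∧ Set.range f = X := by
  obtain ⟨e, he⟩ := h
  refine ⟨fun x => e.symm x, fun x y hxy => e.symm.strictMono hxy, ?_, ?_⟩
  · obtain ⟨-, g, -, hg, hgc⟩ := isHomeomorph_iff_exists_inverse.1 he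
    have hge : ⇑e.symm = g := funext fun x => e.symm_apply_eq.2 (hg x).symm
    exact continuous_subtype_val.comp (hge ▸ hgc)
  · have : (fun x => (e.symm x : T)) = Subtype.val ∘ e.symm := rfl
    rw [this, e.symm.surjective.range_comp, Subtype.range_val]

theorem exists_extend_top {θ : Ordinal.{u}} {f : Set.Iio θ → T} (hf : StrictMono f)
    (hc : Continuous f) {p : T} (hp : ∀ x, f x < p) (hcof : ∀ t < p, ∃ x, t < f x) :
    ∃ F : Set.Iio (θ + 1) → T, StrictMono F ∧ Continuous F ∧
      Set.range F = insert p (Set.range f) := by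
  classical
  let F : Set.Iio (θ + 1) → T := fun x =>
    if h : (x : Ordinal.{u}) < θ then f ⟨x, h⟩ else p
  have hF₁ : ∀ (x : Set.Iio (θ + 1)) (h : (x : Ordinal.{u}) < θ), F x = f ⟨x, h⟩ :=
    fun x h => dif_pos h
  have hF₂ : ∀ (x : Set.Iio (θ + 1)), ¬ (x : Ordinal.{u}) < θ → F x = p := fun x h => dif_neg h
  have hlift : ∀ x : Set.Iio θ, F ⟨x, (show (x : Ordinal.{u}) < θ from x.2).trans
      (Order.lt_add_one_iff.2 le_rfl)⟩ = f x := fun x => hF₁ _ x.2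
  have hmono : StrictMono F := by
    intro x y hxy
    have hx : (x : Ordinal.{u}) < θ :=
      (show (x : Ordinal.{u}) < y from hxy).trans_le (Order.lt_add_one_iff.1 y.2)
    rw [hF₁ x hx]
    by_cases hy : (y : Ordinal.{u}) < θ
    · rw [hF₁ y hy]
      exact hf hxy
    · rw [hF₂ y hy]
      exact hp _
  refine ⟨F, hmono, hmono.continuous_of_isSuccLimit fun x hx t ht => ?_, ?_⟩
  · by_cases h : (x : Ordinal.{u}) < θ
    · rw [hF₁ x h] at ht
      obtain ⟨y, hy, hty⟩ := hc.exists_lt_of_isSuccLimit (x := ⟨x, h⟩) hx ht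
      exact ⟨_, hy, (hlift y).symm ▸ hty⟩
    · rw [hF₂ x h] at ht
      obtain ⟨y, hy⟩ := hcof t ht
      refine ⟨_, ?_, (hlift y).symm ▸ hy⟩
      exact (show (y : Ordinal.{u}) < θ from y.2).trans_le (not_lt.1 h)
  · ext t
    simp only [Set.mem_range, Set.mem_insert_iff]
    constructor
    · rintro ⟨x, rfl⟩
      by_cases h : (x : Ordinal.{u}) < θ
      · exact Or.inr ⟨_, (hF₁ x h).symm⟩
      · exact Or.inl (hF₂ x h)
    · rintro (rfl | ⟨x, rfl⟩)
      · exact ⟨⟨θ, Set.mem_Iio.2 (Order.lt_add_one_iff.2 le_rfl)⟩, hF₂ _ (lt_irrefl _)⟩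
      · exact ⟨_, hlift x⟩

theorem exists_closedCopy_of_accRank [Countable T] {A : Set T} {b : Ordinal.{u}}
    (hb : b.card ≤ ℵ₀) (hb0 : b ≠ 0) {p : T} (h : AccRank A b p) :
    ∃ F : Set.Iio (ω ^ b + 1) → T, StrictMono F ∧ Continuous F ∧
      F ⟨ω ^ b, Set.mem_Iio.2 (Order.lt_add_one_iff.2 le_rfl)⟩ = p ∧
        ∀ x : Set.Iio (ω ^ b + 1), (x : Ordinal.{u}) < ω ^ b → F x ∈ A := by
  obtain ⟨q, -, hqp⟩ := (((accRank_iff.1 h) 0 (pos_iff_ne_zero.2 hb0)).and_eventually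
    self_mem_nhdsWithin).exists
  obtain ⟨g, ⟨hg, hglim⟩, hgtop, hgA⟩ := exists_isNormalOn_of_accRank hb hqp h
  have hω : (ω : Ordinal.{u}) ≤ ω ^ b := by
    simpa using Ordinal.opow_le_opow_right Ordinal.omega0_pos (Order.one_le_iff_ne_zero.2 hb0)
  have h1 : 1 + (ω : Ordinal.{u}) ^ b = ω ^ b := Ordinal.one_add_of_omega0_le hω
  have hpos : ∀ x : Ordinal.{u}, 0 < 1 + x := fun x => zero_lt_one.trans_le le_self_add
  -- The normal map lives on (0, ω^b]; the shift 1 + x moves its domain to [0, ω^b] and fixes limit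
  -- ordinals and the top.
  have hmono : StrictMono fun x : Set.Iio (ω ^ b + 1) => g (1 + x) := by
    intro x y hxy
    refine hg _ _ (hpos _) (by gcongr) (le_of_le_of_eq ?_ h1)
    gcongr
    exact Order.lt_add_one_iff.1 y.2
  refine ⟨_, hmono, hmono.continuous_of_isSuccLimit fun x hx t ht => ?_, ?_, ?_⟩
  · have hx1 : 1 + (x : Ordinal.{u}) = x :=
      Ordinal.one_add_of_omega0_le (Ordinal.omega0_le_of_isSuccLimit hx)
    rw [hx1] at ht
    obtain ⟨y, hy0, hyx, hty⟩ := hglim x (Order.lt_add_one_iff.1 x.2) hx t ht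
    have hy1 : 1 + (y - 1) = y :=
      Ordinal.add_sub_cancel_of_le (Order.one_le_iff_pos.2 hy0)
    have hlt : y - 1 < x := (Ordinal.sub_le_self y 1).trans_lt hyx
    refine ⟨⟨y - 1, hlt.trans x.2⟩, hlt, ?_⟩
    rwa [hy1]
  · simp only [h1, hgtop]
  · intro x hx
    refine (hgA _ (hpos _) (lt_of_lt_of_eq ?_ h1)).2
    gcongr

theorem isClosedCopy_finset {B : Finset T} {m : ℕ} (hB : B.card = m) :
    IsClosedCopy (B : Set T) (m : Ordinal.{u}) := by
  have hnat : ∀ x : Set.Iio (m : Ordinal.{u}), ∃ i : Fin m, (x : Ordinal.{u}) = (i : ℕ) := by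
    intro x
    have hx : (x : Ordinal.{u}) < m := x.2
    obtain ⟨n, hn⟩ := Ordinal.lt_omega0.1 (hx.trans (Ordinal.natCast_lt_omega0 _))
    rw [hn] at hx
    exact ⟨⟨n, by exact_mod_cast hx⟩, hn⟩
  choose i hi using hnat
  let f : Set.Iio (m : Ordinal.{u}) → T := fun x => B.orderEmbOfFin hB (i x)
  have hmono : StrictMono f := by
    intro x y hxy
    refine (B.orderEmbOfFin hB).strictMono ?_
    have : (x : Ordinal.{u}) < y := hxy
    rw [hi, hi] at this
    exact_mod_cast this
  have hcont : Continuous f := hmono.continuous_of_isSuccLimit fun x hx => by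
    have := Ordinal.omega0_le_of_isSuccLimit hx
    rw [hi] at this
    exact absurd (Ordinal.natCast_lt_omega0 _) (not_lt.2 this)
  have hrange : Set.range f = B := by
    rw [← Finset.range_orderEmbOfFin B hB]
    refine Set.Subset.antisymm (by rintro _ ⟨x, rfl⟩; exact ⟨_, rfl⟩) ?_
    rintro _ ⟨j, rfl⟩
    refine ⟨⟨(j : ℕ), show ((j : ℕ) : Ordinal.{u}) < m by exact_mod_cast j.2⟩, ?_⟩
    have : ((j : ℕ) : Ordinal.{u}) = _ := hi ⟨(j : ℕ), show ((j : ℕ) : Ordinal.{u}) < m by exact_mod_cast j.2⟩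
    simp only [f]
    congr 1
    ext
    exact_mod_cast this.symm
  rw [← hrange]
  exact isClosedCopy_range hmono hcont

theorem AccRank.mono {T : Type*} [LinearOrder T] [TopologicalSpace T] {A B : Set T} (hAB : A ⊆ B)
    {b : Ordinal.{u}} {p : T} (h : AccRank A b p) : AccRank B b p := by
  induction b using WellFoundedLT.induction generalizing p with
  | _ b ih =>
    rw [accRank_iff] at h ⊢
    exact fun c hc => (h c hc).mono fun y hy => ⟨hAB hy.1, ih c hc hy.2⟩

/-- In an initial segment of the ordinals, nonzero multiples of `ω ^ b` have rank at least `b`. -/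
theorem accRank_univ {θ : Ordinal.{u}} (b : Ordinal.{u}) {ξ : Ordinal.{u}} (hξ : 0 < ξ)
    (h : ω ^ b * ξ < θ) : AccRank (Set.univ : Set (Set.Iio θ)) b ⟨ω ^ b * ξ, h⟩ := by
  induction b using WellFoundedLT.induction generalizing ξ with
  | _ b ih =>
    rw [accRank_iff]
    intro c hc
    obtain ⟨d, rfl⟩ := exists_add_of_le hc.le
    have hd : d ≠ 0 := by
      rintro rfl
      simp at hc
    have hcpos : (0 : Ordinal.{u}) < ω ^ c := Ordinal.opow_pos _ Ordinal.omega0_pos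
    -- Since ω^d·ξ is a limit, the point is a limit of smaller nonzero multiples of ω^c, which have
    -- rank at least c by induction.
    have hmul : ω ^ (c + d) * ξ = ω ^ c * (ω ^ d * ξ) := by rw [Ordinal.opow_add, mul_assoc]
    have hlim : Order.IsSuccLimit (ω ^ d * ξ) := by
      apply Ordinal.isSuccLimit_mul_left _ hξ
      exact Ordinal.isSuccLimit_opow_left Ordinal.isSuccLimit_omega0 hd
    have hpos : 0 < ω ^ (c + d) * ξ := mul_pos (Ordinal.opow_pos _ Ordinal.omega0_pos) hξ
    rw [(nhdsLT_basis_of_exists_lt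
      ⟨(⟨0, hpos.trans h⟩ : Set.Iio θ), show (0 : Ordinal.{u}) < _ from hpos⟩).frequently_iff]
    rintro q hq
    have hq' : (q : Ordinal.{u}) < ω ^ c * (ω ^ d * ξ) := hmul ▸ hq
    obtain ⟨η, hη, hqη⟩ := (Ordinal.lt_mul_iff_of_isSuccLimit hlim).1 hq'
    have hη' : ω ^ c * η < ω ^ (c + d) * ξ := by
      rw [hmul]
      gcongr
    have hη0 : 0 < η := by
      rw [pos_iff_ne_zero]
      rintro rfl
      simp at hqη
    exact ⟨⟨ω ^ c * η, hη'.trans h⟩, ⟨hqη, hη'⟩, trivial, ih c hc hη0 _⟩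

end Maps

/-! ### Two-colourings as a blue graph. -/

section Colorings

variable {T : Type*} [LinearOrder T]

theorem isHomogeneous_two_iff {ι : Type*} {c : Set.powersetCard T 2 → ι} {X : Set T} {i : ι} :
    IsHomogeneous c X i ↔
      ∀ a ∈ X, ∀ b ∈ X, ∀ h : a ≠ b, c ⟨{a, b}, Finset.card_pair h⟩ = i := by
  constructor
  · intro h a ha b hb hab
    refine h _ ?_
    simp [Set.insert_subset_iff, ha, hb]
  · rintro h ⟨s, hs⟩ hsX
    obtain ⟨a, b, hab, rfl⟩ := Finset.card_eq_two.1 hs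
    simp only [Finset.coe_insert, Finset.coe_singleton, Set.insert_subset_iff,
      Set.singleton_subset_iff] at hsX
    exact h a hsX.1 b hsX.2 hab

/-- The two distinct points `a` and `b` are joined by a blue edge. -/
def Blue (c : Set.powersetCard T 2 → Fin 2) (a b : T) : Prop :=
  ∃ h : a ≠ b, c ⟨{a, b}, Finset.card_pair h⟩ = 1

theorem Blue.symm {c : Set.powersetCard T 2 → Fin 2} {a b : T} (h : Blue c a b) : Blue c b a := by
  obtain ⟨h, hc⟩ := h
  refine ⟨h.symm, ?_⟩
  rw [← hc]
  congr 2
  exact Finset.pair_comm b a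

theorem isHomogeneous_one_iff {c : Set.powersetCard T 2 → Fin 2} {X : Set T} :
    IsHomogeneous c X 1 ↔ ∀ a ∈ X, ∀ b ∈ X, a ≠ b → Blue c a b := by
  rw [isHomogeneous_two_iff]
  exact ⟨fun h a ha b hb hab => ⟨hab, h a ha b hb hab⟩, fun h a ha b hb hab => (h a ha b hb hab).2⟩

theorem isHomogeneous_zero_iff {c : Set.powersetCard T 2 → Fin 2} {X : Set T} :
    IsHomogeneous c X 0 ↔ ∀ a ∈ X, ∀ b ∈ X, ¬ Blue c a b := by
  rw [isHomogeneous_two_iff]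
  refine ⟨fun h a ha b hb hab => ?_, fun h a ha b hb hab => ?_⟩
  · obtain ⟨hab, h1⟩ := hab
    rw [h a ha b hb hab] at h1
    exact zero_ne_one h1
  · have := h a ha b hb
    rw [Blue, not_exists] at this
    have := this hab
    omega

theorem exists_blue_insert {c : Set.powersetCard T 2 → Fin 2} {B : Finset T} {p : T}
    (hB : IsHomogeneous c (B : Set T) 1) (hp : ∀ y ∈ B, Blue c y p) :
    (insert p B).card = B.card + 1 ∧ IsHomogeneous c ((insert p B : Finset T) : Set T) 1 := by
  have hpB : p ∉ B := fun h => (hp p h).1 rfl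
  refine ⟨Finset.card_insert_of_notMem hpB, ?_⟩
  rw [isHomogeneous_one_iff] at hB ⊢
  simp only [Finset.coe_insert]
  rintro a (rfl | ha) b (rfl | hb) hab
  · exact absurd rfl hab
  · exact (hp b hb).symm
  · exact hp a ha
  · exact hB a ha b hb hab

/-- The colouring of pairs pulled back along an injection. -/
def pullColoring {S : Type*} (c : Set.powersetCard T 2 → Fin 2) (f : S ↪ T) :
    Set.powersetCard S 2 → Fin 2 :=
  fun s => c ⟨(s : Finset S).map f, (Finset.card_map f).trans s.2⟩

theorem IsHomogeneous.image {S : Type*} {c : Set.powersetCard T 2 → Fin 2} {f : S ↪ T}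
    {X : Set S} {i : Fin 2} (h : IsHomogeneous (pullColoring c f) X i) :
    IsHomogeneous c (f '' X) i := by
  classical
  rintro ⟨s, hs⟩ hsX
  obtain ⟨t, ht, rfl⟩ := Finset.subset_set_image_iff.1 hsX
  have ht2 : t.card = 2 := by
    have hs2 : (t.image f).card = 2 := hs
    rwa [Finset.card_image_of_injective _ f.injective] at hs2
  rw [← h ⟨t, ht2⟩ ht]
  simp only [pullColoring, Finset.map_eq_image]

end Colorings

/-! ### Growing blue sets along the rank. -/

section Main

variable {T : Type*} [LinearOrder T] [TopologicalSpace T] [OrderTopology T] [Countable T]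
  {c : Set.powersetCard T 2 → Fin 2} {α β : Ordinal.{u}} {m : ℕ}

theorem lt_self_add_one (θ : Ordinal.{u}) : θ < θ + 1 := Order.lt_add_one_iff.2 le_rfl

/-- If all points of rank `ω ^ α` in `A` below `p` are joined to `p` in red, then the cofinal
partition relation supplies one of the two homogeneous sets. -/
theorem not_accRank_of_forall_not_blue (hα : α.card ≤ ℵ₀)
    (hcof : CofinalClosedArrow (ω ^ (ω ^ α)) (ω ^ β) m)
    (hred : ¬ ∃ X, IsHomogeneous c X 0 ∧ IsClosedCopy X (ω ^ β + 1))
    (hblue : ¬ ∃ B : Finset T, B.card = m ∧ IsHomogeneous c (B : Set T) 1)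
    {A : Set T} {p : T} (hA : ∀ y ∈ A, ¬ Blue c y p) : ¬ AccRank A (ω ^ α) p := by
  intro hrank
  have hα0 : (ω : Ordinal.{u}) ^ α ≠ 0 := (Ordinal.opow_pos α Ordinal.omega0_pos).ne'
  have hαc : (ω ^ α : Ordinal.{u}).card ≤ ℵ₀ :=
    (Ordinal.card_opow_le _ _).trans (by simp [hα])
  obtain ⟨F, hF, hFc, hFp, hFA⟩ := exists_closedCopy_of_accRank hαc hα0 hrank
  let δ : Ordinal.{u} := ω ^ (ω ^ α)
  let ι : Set.Iio δ → Set.Iio (δ + 1) := fun x => ⟨x, lt_trans x.2 (lt_self_add_one δ)⟩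
  have hι : StrictMono ι := fun x y h => h
  have hιc : Continuous ι := continuous_subtype_val.subtype_mk _
  let f : Set.Iio δ ↪ T := ⟨F ∘ ι, (hF.comp hι).injective⟩
  have hf : StrictMono f := hF.comp hι
  have hfc : Continuous f := hFc.comp hιc
  have hfA : ∀ x, f x ∈ A := fun x => hFA (ι x) x.2
  rcases hcof (pullColoring c f) with ⟨B, hB, hBh⟩ | ⟨X, hX, hXc, hXcof⟩ | ⟨X, hX, hXc⟩
  · refine hblue ⟨B.map f, (Finset.card_map f).trans hB, ?_⟩
    rw [Finset.coe_map]
    exact hBh.image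
  · obtain ⟨g, hg, hgc, rfl⟩ := hXc.exists_strictMono_continuous
    have hδ : Order.IsSuccLimit δ :=
      Ordinal.isSuccLimit_opow_left Ordinal.isSuccLimit_omega0 hα0
    -- Cofinality of the red copy of ω^β lets the point δ, which `F` sends to p, be added as its
    -- limit. Cofinality is applied at t + 1 because it only gives a weak inequality.
    obtain ⟨G, hG, hGc, hGr⟩ := exists_extend_top (hι.comp hg) (hιc.comp hgc)
      (p := ⟨δ, lt_self_add_one δ⟩) (fun x => (g x).2) (by
        intro t ht
        obtain ⟨_, ⟨x, rfl⟩, hx⟩ := hXcof ⟨t + 1, hδ.add_one_lt ht⟩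
        exact ⟨x, (lt_self_add_one (t : Ordinal.{u})).trans_le hx⟩)
    refine hred ⟨_, ?_, isClosedCopy_range (hF.comp hG) (hFc.comp hGc)⟩
    have hr : Set.range (F ∘ G) = insert p (f '' Set.range g) := by
      rw [Set.range_comp, hGr, Set.image_insert_eq, hFp, ← Set.range_comp, ← Set.range_comp]
      rfl
    have himg := hX.image
    rw [hr]
    rw [isHomogeneous_zero_iff] at himg ⊢
    have hpA : ∀ y ∈ f '' Set.range g, ¬ Blue c y p := by
      rintro _ ⟨x, -, rfl⟩
      exact hA _ (hfA x)
    rintro a (rfl | ha) b (rfl | hb)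
    · exact fun h => h.1 rfl
    · exact fun h => hpA b hb h.symm
    · exact hpA a ha
    · exact himg a ha b hb
  · obtain ⟨g, hg, hgc, rfl⟩ := hXc.exists_strictMono_continuous
    refine hred ⟨Set.range (f ∘ g), ?_, isClosedCopy_range (hf.comp hg) (hfc.comp hgc)⟩
    rw [Set.range_comp]
    exact hX.image

/-- The non-blue part has rank below ω^α at p, so by the pigeonhole the blue part must carry rank a
+ 1 there, and hence contains a point of rank a. -/
theorem exists_accRank_blue_neighbours (hα : α.card ≤ ℵ₀)
    (hcof : CofinalClosedArrow (ω ^ (ω ^ α)) (ω ^ β) m)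
    (hred : ¬ ∃ X, IsHomogeneous c X 0 ∧ IsClosedCopy X (ω ^ β + 1))
    (hblue : ¬ ∃ B : Finset T, B.card = m ∧ IsHomogeneous c (B : Set T) 1)
    {U : Set T} {p : T} {a γ : Ordinal.{u}} (hU : AccRank U γ p)
    (haγ : ∀ b < ω ^ α, ∃ d < γ, NatAddLE a b d) :
    ∃ y ∈ {y ∈ U | Blue c y p}, AccRank {y ∈ U | Blue c y p} a y := by
  by_contra! hcon
  have hU' : AccRank ({y ∈ U | Blue c y p} ∪ {y | ¬ Blue c y p}) γ p := by
    refine hU.mono fun y hy => ?_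
    by_cases h : Blue c y p
    · exact Or.inl ⟨hy, h⟩
    · exact Or.inr h
  obtain ⟨b, hb, hbn⟩ := exists_lt_not_accRank_add_one
    (not_accRank_of_forall_not_blue hα hcof hred hblue (A := {y | ¬ Blue c y p}) (p := p)
      fun y hy => hy)
  obtain ⟨d, hd, hN⟩ := haγ b hb
  rcases hU'.union hN hd with h | h
  · rw [accRank_add_one_iff] at h
    obtain ⟨y, hy, hyr⟩ := h.exists
    exact hcon y hy hyr
  · exact hbn h

theorem natAddLE_mul_natCast {α : Ordinal.{u}} (n : ℕ) :
    ∀ b < ω ^ α, ∃ d < ω ^ α * ((n + 1 : ℕ) : Ordinal.{u}),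
      NatAddLE (ω ^ α * (n : Ordinal.{u})) b d := by
  intro b hb
  have hpos : (0 : Ordinal.{u}) < ω ^ α := Ordinal.opow_pos _ Ordinal.omega0_pos
  obtain ⟨d, hd, hN⟩ := NatAddLE.exists_lt_opow α 0 hpos b hb
  have h := NatAddLE.opow_mul_add (NatAddLE.exists_lt_opow α) n n 0 (add_zero n) hN hpos hb hd
  simp only [Nat.cast_zero, mul_zero, add_zero, zero_add] at h
  refine ⟨_, ?_, h⟩
  push_cast
  rw [mul_add, mul_one]
  gcongr

/-- Blue homogeneous sets grow by one point each time the rank grows by `ω ^ α`. -/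
theorem exists_blue_of_accRank (hα : α.card ≤ ℵ₀)
    (hcof : CofinalClosedArrow (ω ^ (ω ^ α)) (ω ^ β) m)
    (hred : ¬ ∃ X, IsHomogeneous c X 0 ∧ IsClosedCopy X (ω ^ β + 1))
    (hblue : ¬ ∃ B : Finset T, B.card = m ∧ IsHomogeneous c (B : Set T) 1) {n s : ℕ}
    (hbase : ∀ (U : Set T) (p : T), AccRank U (ω ^ α * (n : Ordinal.{u})) p →
      ∃ B : Finset T, (B : Set T) ⊆ insert p U ∧ B.card = s ∧ IsHomogeneous c (B : Set T) 1)
    (j : ℕ) (U : Set T) (p : T) (h : AccRank U (ω ^ α * ((n + j : ℕ) : Ordinal.{u})) p) :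
    ∃ B : Finset T, (B : Set T) ⊆ insert p U ∧ B.card = s + j ∧
      IsHomogeneous c (B : Set T) 1 := by
  induction j generalizing U p with
  | zero => exact hbase U p h
  | succ j ih =>
    obtain ⟨y, hy, hyr⟩ := exists_accRank_blue_neighbours hα hcof hred hblue h
      (natAddLE_mul_natCast (n + j))
    obtain ⟨B, hBU, hB, hBh⟩ := ih _ _ hyr
    rw [Set.insert_eq_of_mem hy] at hBU
    obtain ⟨hcard, hhom⟩ := exists_blue_insert hBh fun z hz => (hBU hz).2
    refine ⟨insert p B, ?_, by rw [hcard, hB, add_assoc], hhom⟩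
    rw [Finset.coe_insert]
    exact Set.insert_subset_insert fun z hz => (hBU hz).1

/-- Because β < ω^α, some blue neighbour of p has rank β over the blue neighbours, which therefore
contain a closed copy of ω^β + 1. It is not red-homogeneous, and a blue edge in it closes a triangle
with p. -/
theorem exists_blue_card_three (hα : α.card ≤ ℵ₀) (hβ : β.card ≤ ℵ₀) (hβ0 : 0 < β)
    (hβα : β < ω ^ α)
    (hcof : CofinalClosedArrow (ω ^ (ω ^ α)) (ω ^ β) m)
    (hred : ¬ ∃ X, IsHomogeneous c X 0 ∧ IsClosedCopy X (ω ^ β + 1))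
    (hblue : ¬ ∃ B : Finset T, B.card = m ∧ IsHomogeneous c (B : Set T) 1)
    (U : Set T) (p : T) (h : AccRank U (ω ^ α * ((1 : ℕ) : Ordinal.{u})) p) :
    ∃ B : Finset T, (B : Set T) ⊆ insert p U ∧ B.card = 3 ∧ IsHomogeneous c (B : Set T) 1 := by
  rw [Nat.cast_one, mul_one] at h
  obtain ⟨y, hy, hyr⟩ := exists_accRank_blue_neighbours hα hcof hred hblue h
    fun b hb => NatAddLE.exists_lt_opow α β hβα b hb
  obtain ⟨F, hF, hFc, hFy, hFU⟩ := exists_closedCopy_of_accRank hβ hβ0.ne' hyr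
  have hnh : ¬ IsHomogeneous c (Set.range F) 0 := fun hh =>
    hred ⟨_, hh, isClosedCopy_range hF hFc⟩
  have hFU' : ∀ x, F x ∈ {y ∈ U | Blue c y p} := by
    intro x
    rcases (Order.lt_add_one_iff.1 x.2 : (x : Ordinal.{u}) ≤ ω ^ β).lt_or_eq with hx | hx
    · exact hFU x hx
    · rw [show x = ⟨ω ^ β, lt_self_add_one _⟩ from Subtype.ext hx, hFy]
      exact hy
  rw [isHomogeneous_zero_iff] at hnh
  push Not at hnh
  obtain ⟨_, ⟨a, rfl⟩, _, ⟨b, rfl⟩, hab⟩ := hnh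
  obtain ⟨hcard₁, hhom₁⟩ := exists_blue_insert (c := c) (B := {F a}) (p := F b)
    (isHomogeneous_one_iff.2 (by
      simp only [Finset.coe_singleton, Set.mem_singleton_iff]
      rintro _ rfl _ rfl h
      exact absurd rfl h))
    (by simpa using hab)
  obtain ⟨hcard₂, hhom₂⟩ := exists_blue_insert (p := p) hhom₁
    (by simpa using ⟨(hFU' b).2, (hFU' a).2⟩)
  refine ⟨_, ?_, by rw [hcard₂, hcard₁, Finset.card_singleton], hhom₂⟩
  simp only [Finset.coe_insert, Finset.coe_singleton]
  refine Set.insert_subset_insert ?_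
  simp [Set.insert_subset_iff, (hFU' a).1, (hFU' b).1]

theorem closedArrow_of_exists_blue {γ δ : Ordinal.{u}} {m : ℕ} (hγ : γ.card ≤ ℵ₀)
    (h : ∀ c : Set.powersetCard (Set.Iio (ω ^ γ + 1)) 2 → Fin 2,
      (¬ ∃ X, IsHomogeneous c X 0 ∧ IsClosedCopy X δ) →
      (¬ ∃ B : Finset (Set.Iio (ω ^ γ + 1)), B.card = m ∧
        IsHomogeneous c (B : Set (Set.Iio (ω ^ γ + 1))) 1) →
      Countable (Set.Iio (ω ^ γ + 1)) →
      ∀ p, AccRank (Set.univ : Set (Set.Iio (ω ^ γ + 1))) γ p →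
      ∃ B : Finset (Set.Iio (ω ^ γ + 1)), B.card = m ∧
        IsHomogeneous c (B : Set (Set.Iio (ω ^ γ + 1))) 1) :
    ClosedArrow (ω ^ γ + 1) ![δ, (m : Ordinal.{u})] 2 := by
  intro c
  by_cases hred : ∃ X, IsHomogeneous c X 0 ∧ IsClosedCopy X δ
  · obtain ⟨X, hX, hXc⟩ := hred
    exact ⟨X, 0, hX, hXc⟩
  by_cases hblue : ∃ B : Finset (Set.Iio (ω ^ γ + 1)), B.card = m ∧
      IsHomogeneous c (B : Set (Set.Iio (ω ^ γ + 1))) 1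
  · obtain ⟨B, hB, hBh⟩ := hblue
    exact ⟨B, 1, hBh, isClosedCopy_finset hB⟩
  refine absurd ?_ hblue
  have hcount : Countable (Set.Iio (ω ^ γ + 1)) := by
    rw [← Cardinal.mk_le_aleph0_iff, Cardinal.mk_Iio_ordinal, Cardinal.lift_le_aleph0,
      Ordinal.card_add, Ordinal.card_one]
    refine Cardinal.add_le_aleph0.2 ⟨(Ordinal.card_opow_le _ _).trans ?_, Cardinal.one_le_aleph0⟩
    simp [hγ]
  refine h c hred hblue hcount _ (accRank_univ γ (ξ := 1) zero_lt_one ?_)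
  rw [mul_one]
  exact lt_self_add_one _

end Main

theorem mainTheorem7 (α β : Ordinal.{u}) (hα : α.card ≤ ℵ₀) (hβ : β.card ≤ ℵ₀) (hβ0 : 0 < β)
    (k : ℕ) (hk : 0 < k)
    (hcof : CofinalClosedArrow (ω ^ (ω ^ α)) (ω ^ β) (k + 2)) :
    ClosedArrow (ω ^ (ω ^ α * ((k + 1 : ℕ) : Ordinal.{u})) + 1)
        ![ω ^ β + 1, ((k + 2 : ℕ) : Ordinal.{u})] 2 ∧
      (ω ^ β < ω ^ (ω ^ α) →
        ClosedArrow (ω ^ (ω ^ α * (k : Ordinal.{u})) + 1)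
          ![ω ^ β + 1, ((k + 2 : ℕ) : Ordinal.{u})] 2) := by
  have hcard : ∀ n : ℕ, (ω ^ α * (n : Ordinal.{u})).card ≤ ℵ₀ := by
    intro n
    rw [Ordinal.card_mul, Ordinal.card_nat]
    exact (mul_le_mul' ((Ordinal.card_opow_le _ _).trans (by simp [hα]))
      Cardinal.natCast_le_aleph0).trans Cardinal.aleph0_mul_aleph0.le
  refine ⟨closedArrow_of_exists_blue (hcard _) fun c hred hblue _ p hp => ?_, fun hlt =>
    closedArrow_of_exists_blue (hcard _) fun c hred hblue _ p hp => ?_⟩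
  -- Start from the singleton at rank 0: k + 1 descents give 1 + (k + 1) points.
  · obtain ⟨B, -, hB, hBh⟩ := exists_blue_of_accRank hα hcof hred hblue (n := 0) (s := 1)
      (fun U p _ => ⟨{p}, by simp, by simp, isHomogeneous_one_iff.2 (by
        simp only [Finset.coe_singleton, Set.mem_singleton_iff]
        rintro _ rfl _ rfl h
        exact absurd rfl h)⟩) (k + 1) Set.univ p (by rwa [zero_add])
    exact ⟨B, by omega, hBh⟩
  · obtain ⟨j, rfl⟩ := Nat.exists_eq_add_of_le hk
    -- Start from a triangle at rank ω^α: the remaining j = k - 1 descents give 3 + j = k + 2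
    -- points.
    obtain ⟨B, -, hB, hBh⟩ := exists_blue_of_accRank hα hcof hred hblue (n := 1) (s := 3)
      (fun U p h => exists_blue_card_three hα hβ hβ0
        ((Ordinal.opow_lt_opow_iff_right Ordinal.one_lt_omega0).1 hlt) hcof hred hblue U p h)
      j Set.univ p hp
    exact ⟨B, by omega, hBh⟩
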